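/- Let $G=(U\cup W,E)$ be a finite connected bipartite simple graph with parts $U$, $W$, $|U|=n$, $|W|=m$, in which every vertex of $U$ has degree $q_1+1$ and every vertex of $W$ has degree $q_2+1$, where $q_1\ge 1$, $q_2\ge 2$ and $q_2\ge q_1$. Let $g$ be the girth of $G$, let $H$ be the real $m\times n$ zero-one biadjacency matrix of $G$ (rows indexed by $W$, columns by $U$), and let $\mu$ be the rank of $H$. Let $\alpha$ run, with multiplicity, through the eigenvalues of $HH^{\mathsf T}-(q_1+q_2)I_m$ different from $-(q_1+q_2)$, and put $E_k=\sum_\alpha\alpha^k$ for $k\ge 0$ (with $0^0=1$) and $E_k=0$ for $k<0$. Let $N_{2k}$ be the number of cycles of length $2k$ in $G$. For real $p,\alpha$ define $S_1=\alpha$, $S_2=\alpha^2-2p$ and $S_k=\alpha S_{k-1}-pS_{k-2}$ for $k\ge 3$. Define non-negative integers $c_{k,i}$ ($k\ge1$, $i\ge0$) by the corresponding recursion: $c_{1,0}=1$, $c_{2,0}=1$, $c_{2,1}=2$, all other $c_{1,i}$ and $c_{2,i}$ are $0$, and $c_{k,i}=c_{k-1,i}+c_{k-2,i-1}$ for $k\ge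 3$ (with $c_{k,-1}=0$). Then for all real $p,\alpha$ and all $k\ge1$ $$S_k=\sum_{i=0}^{\lfloor k/2\rfloor}(-1)^i c_{k,i}\,p^i\alpha^{k-2i},$$ and $c_{k,0}=1$ for $k\ge 1$, $c_{k,1}=k$ for $k\ge2$, $c_{k,2}=\frac{k(k-3)}2$ for $k\ge4$, $c_{k,3}=\frac{k(k-4)(k-5)}6$ for $k\ge6$. Moreover, the number of the eigenvalues $\alpha$ (with multiplicity) is $\mu$, and for every integer $k$ with $1\le k<g$, writing $$T_k=E_k-kq_1q_2E_{k-2}+\tfrac{k(k-3)}2q_1^2q_2^2E_{k-4}-\tfrac{k(k-4)(k-5)}6q_1^3q_2^3E_{k-6}+\sum_{4\le i\le k/2}(-1)^ic_{k,i}\,q_1^iq_2^i\,E_{k-2i},$$ one has $$N_{2k}=\frac{|E|-(m+n)+(-q_1)^k(n-\mu)+(-q_2)^k(m-\mu)+T_k}{2k}$$ $$\phantom{N_{2k}}=\frac{|E|\left(1+\frac{(-q_1)^k-1}{q_1+1}+\frac{(-q_2)^k-1}{q_2+1}\right)-\mu\left((-q_1)^k+(-q_2)^k\right)+T_k}{2k}.$$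 For $k\le 7$ (and $1\le k<g$) both formulas also hold with $$T_k=E_k-kq_1q_2E_{k-2}+\tfrac{k(k-3)}2q_1^2q_2^2E_{k-4}-(k^2-8k+14)q_1^3q_2^3E_{k-6}.$$ -/

import Mathlib

namespace CycleCount

/-- The number of cycles of length `l` in `G`, a cycle being a subgraph of `G`
(no base point, no orientation). -/
noncomputable def numCycles {V : Type*} (G : SimpleGraph V) (l : ℕ) : ℕ :=
  {C : G.Subgraph | ∃ (v : V) (p : G.Walk v v),
    p.IsCycle ∧ p.length = l ∧ p.toSubgraph = C}.ncard

/-- The `0/1` biadjacency (parity-check) matrix, rows indexed by `W`, columns by `U`. -/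
def biadj {V : Type*} (G : SimpleGraph V) [DecidableRel G.Adj] (U W : Finset V) :
    Matrix W U ℝ :=
  Matrix.of fun w u => if G.Adj w u then 1 else 0

/-- The multiset of those eigenvalues `α` of `H Hᵀ - (q₁ + q₂) I`, with multiplicity, that
are different from `-(q₁ + q₂)`. The matrix is real symmetric, so its eigenvalues are the
real roots of its characteristic polynomial. -/
noncomputable def alphas {I J : Type*} [Fintype I] [DecidableEq I] [Fintype J]
    (H : Matrix I J ℝ) (q₁ q₂ : ℕ) : Multiset ℝ :=
  (H * H.transpose - ((q₁ : ℝ) + q₂) • (1 : Matrix I I ℝ)).charpoly.roots.filter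
    fun α => α ≠ -((q₁ : ℝ) + q₂)

/-- `E_k`, the `k`-th power sum of a multiset of reals, with `E_k = 0` for `k < 0`. -/
noncomputable def powerSum (s : Multiset ℝ) (k : ℤ) : ℝ :=
  if 0 ≤ k then (s.map fun α => α ^ k.toNat).sum else 0

/-- The recursion `S₁ = α`, `S₂ = α² - 2p`, `S_k = α S_{k-1} - p S_{k-2}` for `k ≥ 3`
(used with `p = q₁ q₂`; the value at `k = 0` is never used). -/
def newtonS (p α : ℝ) : ℕ → ℝ
  | 0 => 2
  | 1 => α
  | 2 => α ^ 2 - 2 * p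
  | k + 3 => α * newtonS p α (k + 2) - p * newtonS p α (k + 1)

/-- Absolute values `c k i` of the coefficients of `p^i α^{k-2i}` in `S_k`, computed by the same
recursion: `S₁` has the single coefficient `1`, `S₂` has the coefficients `1, 2`, and
`c k i = c (k-1) i + c (k-2) (i-1)` for `k ≥ 3` (the row `k = 0` is never used). -/
def newtonCoeff : ℕ → ℕ → ℕ
  | 0, i => if i = 0 then 2 else 0
  | 1, i => if i = 0 then 1 else 0
  | 2, i => if i = 0 then 1 else if i = 1 then 2 else 0
  | k + 3, 0 => newtonCoeff (k + 2) 0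
  | k + 3, i + 1 => newtonCoeff (k + 2) (i + 1) + newtonCoeff (k + 1) i

end CycleCount

/-! Let `B` be the non-backtracking matrix on darts. The trace of `B ^ (2k)` is evaluated in two
ways.

Combinatorially it counts closed non-backtracking vertex sequences of length `2k`. A repeated vertex
would split such a sequence into two closed arcs, each at least as long as the girth `g`, so for `k
< g` the sequence is injective. It is then a cycle with one of `2k` base points and one of two
directions, and the trace is `4k N_{2k}` (`card_isClosedNonbacktracking`).

Spectrally, the Ihara–Bass identity (`det_smul_one_sub_nonbacktracking`) turns the characteristic
polynomial of `B` into a determinant over vertices. Bipartiteness and the two degrees reduce that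
determinant to `H Hᵀ` (`det_bass_bipartite`). In `x = u²`, an eigenvalue `λ` of `H Hᵀ` contributes
the factor `x² - αx + q₁q₂` with `α = λ - (q₁ + q₂)`, whose roots have `k`-th power sum `S_k`. For
`λ = 0` the roots are `-q₁` and `-q₂`, which accounts for the terms with `μ`.

Expanding `S_k` in powers of `α` and summing gives `T_k` (`sum_map_newtonS`). -/

namespace CycleCount

section

open Polynomial Matrix

/-! ### Traces of matrix powers as power sums of eigenvalues -/

section TracePow

variable {K n : Type*} [Field K] [IsAlgClosed K] [Fintype n] [DecidableEq n]

/-- Both sides are multiplicative in `P`, and over an algebraically closed field `P` is a product of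
a constant and linear factors, so those two cases suffice. -/
theorem det_aeval_eq_prod_roots_charpoly (M : Matrix n n K) (P : K[X]) :
    (aeval M P).det = (M.charpoly.roots.map fun r => P.eval r).prod := by
  have hcard : M.charpoly.roots.card = Fintype.card n := by
    rw [← (IsAlgClosed.splits M.charpoly).natDegree_eq_card_roots, M.charpoly_natDegree_eq_dim]
  have hmul : ∀ P Q : K[X],
      (aeval M P).det = (M.charpoly.roots.map fun r => P.eval r).prod →
      (aeval M Q).det = (M.charpoly.roots.map fun r => Q.eval r).prod →
      (aeval M (P * Q)).det = (M.charpoly.roots.map fun r => (P * Q).eval r).prod := by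
    intro P Q hP hQ
    simp only [map_mul, det_mul, hP, hQ, eval_mul, Multiset.prod_map_mul]
  have hC : ∀ c : K, (aeval M (C c)).det =
      (M.charpoly.roots.map fun r => (C c).eval r).prod := by
    intro c
    simp [hcard, Matrix.algebraMap_eq_diagonal]
  have hX : ∀ a : K, (aeval M (X - C a)).det =
      (M.charpoly.roots.map fun r => (X - C a).eval r).prod := by
    intro a
    have h1 : (aeval M (X - C a)) = -(Matrix.scalar n a - M) := by
      simp [Matrix.algebraMap_eq_diagonal, Matrix.scalar_apply]
    rw [h1, det_neg, ← Matrix.eval_charpoly]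
    conv_lhs => rw [(IsAlgClosed.splits M.charpoly).eq_prod_roots_of_monic M.charpoly_monic]
    rw [eval_multiset_prod, Multiset.map_map, ← hcard]
    have h2 : (M.charpoly.roots.map fun r => (X - C a).eval r) =
        (M.charpoly.roots.map fun r => (-1) * (a - r)) := by
      refine Multiset.map_congr rfl fun r _ => ?_
      simp
    rw [h2, Multiset.prod_map_mul]
    simp
  rw [(IsAlgClosed.splits P).eq_prod_roots]
  refine hmul _ _ (hC _) ?_
  induction P.roots using Multiset.induction_on with
  | empty => simp
  | cons a s ih =>
    rw [Multiset.map_cons, Multiset.prod_cons]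
    exact hmul _ _ (hX a) ih

/-- This is the previous identity for `P = c - X ^ k`, at every scalar `c`. -/
theorem charpoly_pow_eq_prod (M : Matrix n n K) (k : ℕ) :
    (M ^ k).charpoly = (M.charpoly.roots.map fun r => X - C (r ^ k)).prod := by
  refine Polynomial.funext fun c => ?_
  rw [Matrix.eval_charpoly, eval_multiset_prod, Multiset.map_map]
  have := det_aeval_eq_prod_roots_charpoly M (C c - X ^ k)
  simp only [map_sub, aeval_C, map_pow, aeval_X, eval_sub, eval_C, eval_pow, eval_X] at this
  rw [show Matrix.scalar n c = algebraMap K (Matrix n n K) c from rfl, this]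
  simp

theorem trace_pow_eq_sum_roots_charpoly (M : Matrix n n K) (k : ℕ) :
    (M ^ k).trace = (M.charpoly.roots.map fun r => r ^ k).sum := by
  rw [trace_eq_sum_roots_charpoly, charpoly_pow_eq_prod]
  have : (M.charpoly.roots.map fun r => X - C (r ^ k)) =
      ((M.charpoly.roots.map fun r => r ^ k).map fun r => X - C r) := by
    rw [Multiset.map_map]; rfl
  rw [this, roots_multiset_prod_X_sub_C]

end TracePow

/-! ### Power sums of polynomial roots -/

section RootPowerSum

/-- The `k`-th power sum of the roots of a polynomial. -/
noncomputable def rootPowerSum (f : ℂ[X]) (k : ℕ) : ℂ := (f.roots.map fun r => r ^ k).sum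

theorem rootPowerSum_mul {f g : ℂ[X]} (hf : f ≠ 0) (hg : g ≠ 0) (k : ℕ) :
    rootPowerSum (f * g) k = rootPowerSum f k + rootPowerSum g k := by
  simp [rootPowerSum, roots_mul (mul_ne_zero hf hg)]

theorem rootPowerSum_pow (f : ℂ[X]) (j k : ℕ) :
    rootPowerSum (f ^ j) k = j * rootPowerSum f k := by
  simp [rootPowerSum, Multiset.map_nsmul, Multiset.sum_nsmul]

theorem rootPowerSum_X_sub_C (a : ℂ) (k : ℕ) : rootPowerSum (X - C a) k = a ^ k := by
  simp [rootPowerSum]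

theorem rootPowerSum_X_add_C (a : ℂ) (k : ℕ) : rootPowerSum (X + C a) k = (-a) ^ k := by
  simp [rootPowerSum]

theorem rootPowerSum_prod {ι : Type*} (s : Finset ι) (f : ι → ℂ[X]) (hf : ∀ i, f i ≠ 0) (k : ℕ) :
    rootPowerSum (∏ i ∈ s, f i) k = ∑ i ∈ s, rootPowerSum (f i) k := by
  classical
  induction s using Finset.induction_on with
  | empty => simp [rootPowerSum]
  | insert a s ha ih =>
    rw [Finset.prod_insert ha, Finset.sum_insert ha,
      rootPowerSum_mul (hf a) (Finset.prod_ne_zero_iff.2 fun i _ => hf i), ih]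

/-- Each root `a` of `f` is replaced by the two square roots of `a`, and each of these has `2k`-th
power `a ^ k`. -/
theorem rootPowerSum_expand_two (f : ℂ[X]) (k : ℕ) :
    rootPowerSum (expand ℂ 2 f) (2 * k) = 2 * rootPowerSum f k := by
  by_cases hf : f = 0
  · simp [hf, rootPowerSum]
  have hlin : ∀ a : ℂ, (expand ℂ 2 (X - C a)) ≠ 0 := fun a => by
    rw [Ne, expand_eq_zero two_pos]; exact X_sub_C_ne_zero a
  have hX : ∀ a : ℂ, rootPowerSum (expand ℂ 2 (X - C a)) (2 * k) = 2 * a ^ k := by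
    intro a
    obtain ⟨s, hs⟩ := IsAlgClosed.exists_pow_nat_eq a two_pos
    have : expand ℂ 2 (X - C a) = (X - C s) * (X + C s) := by
      rw [map_sub, expand_X, expand_C, ← hs, C_pow]; ring
    rw [this, rootPowerSum_mul (X_sub_C_ne_zero s) (X_add_C_ne_zero s), rootPowerSum_X_sub_C,
      rootPowerSum_X_add_C, pow_mul, pow_mul, neg_sq, hs, two_mul]
  have hprod : ∀ s : Multiset ℂ,
      rootPowerSum (expand ℂ 2 (s.map fun a => X - C a).prod) (2 * k) =
        2 * (s.map fun r => r ^ k).sum := by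
    intro s
    induction s using Multiset.induction_on with
    | empty => simp [rootPowerSum]
    | cons a s ih =>
      have h0 : expand ℂ 2 (s.map fun a => X - C a).prod ≠ 0 := by
        rw [Ne, expand_eq_zero two_pos]
        exact (monic_multiset_prod_of_monic _ _ fun a _ => monic_X_sub_C a).ne_zero
      rw [Multiset.map_cons, Multiset.prod_cons, map_mul, rootPowerSum_mul (hlin a) h0, hX, ih,
        Multiset.map_cons, Multiset.sum_cons, mul_add]
  have h := (IsAlgClosed.splits f).eq_prod_roots
  have hroots : (expand ℂ 2 f).roots = (expand ℂ 2 (f.roots.map fun a => X - C a).prod).roots := by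
    conv_lhs => rw [h]
    rw [map_mul, expand_C, roots_C_mul _ (leadingCoeff_ne_zero.2 hf)]
  rw [rootPowerSum, hroots]
  exact hprod _

theorem newtonS_eq_add_pow {a b : ℂ} {p α : ℝ} (hs : a + b = α) (hp : a * b = p) :
    ∀ k : ℕ, (newtonS p α k : ℂ) = a ^ k + b ^ k
  | 0 => by norm_num [newtonS]
  | 1 => by simp [newtonS, hs]
  | 2 => by simp only [newtonS]; push_cast; rw [← hs, ← hp]; ring
  | k + 3 => by
    simp only [newtonS]
    push_cast
    rw [newtonS_eq_add_pow hs hp (k + 2), newtonS_eq_add_pow hs hp (k + 1), ← hs, ← hp]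
    ring

theorem rootPowerSum_quadratic (p α : ℝ) (k : ℕ) :
    rootPowerSum (X ^ 2 - C (α : ℂ) * X + C (p : ℂ)) k = newtonS p α k := by
  obtain ⟨s, hs⟩ := IsAlgClosed.exists_pow_nat_eq ((α : ℂ) ^ 2 - 4 * p) two_pos
  have hsum : (α + s) / 2 + (α - s) / 2 = (α : ℂ) := by ring
  have hprod : (α + s) / 2 * ((α - s) / 2) = (p : ℂ) := by linear_combination -hs / 4
  have : (X ^ 2 - C (α : ℂ) * X + C (p : ℂ) : ℂ[X]) =
      (X - C ((α + s) / 2)) * (X - C ((α - s) / 2)) := by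
    have hs' : C ((α + s) / 2) + C ((α - s) / 2) = C (α : ℂ) := by rw [← C_add, hsum]
    have hp' : C ((α + s) / 2) * C ((α - s) / 2) = C (p : ℂ) := by rw [← C_mul, hprod]
    linear_combination X * hs' - hp'
  rw [this, rootPowerSum_mul (X_sub_C_ne_zero _) (X_sub_C_ne_zero _), rootPowerSum_X_sub_C,
    rootPowerSum_X_sub_C, newtonS_eq_add_pow hsum hprod]

end RootPowerSum

/-! ### Determinant identities for the Ihara–Bass formula -/

section Determinants

variable {K D V : Type*} [Field K] [Fintype D] [DecidableEq D] [Fintype V] [DecidableEq V]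

/-- The determinant identity behind the Ihara–Bass formula. -/
theorem det_smul_one_sub_nonbacktracking (S T : Matrix V D K) (J : Matrix D D K)
    (hJ : J * J = 1) (hS : S * J = T) (u : K) (hu : u ^ 2 - 1 ≠ 0) :
    (u • (1 : Matrix D D K) - (Tᵀ * S - J)).det * (u ^ 2 - 1) ^ Fintype.card V =
      (u • (1 : Matrix D D K) + J).det *
        ((u ^ 2 - 1) • (1 : Matrix V V K) - (u • (S * Tᵀ) - T * Tᵀ)).det := by
  -- `N` inverts `u + J` because `J` is an involution. With `u + J` factored out, `det (1 - AB) =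
  -- det (1 - BA)` passes from darts to vertices.
  set N : Matrix D D K := (u ^ 2 - 1)⁻¹ • (u • 1 - J) with hN
  have h1 : (u • (1 : Matrix D D K) + J) * N = 1 := by
    rw [hN, Matrix.mul_smul, Matrix.add_mul, Matrix.mul_sub, Matrix.mul_sub]
    simp only [Matrix.smul_mul, Matrix.mul_smul, Matrix.one_mul, Matrix.mul_one, hJ]
    have : u • u • (1 : Matrix D D K) - u • J + (u • J - 1) = (u ^ 2 - 1) • 1 := by
      rw [sub_smul, sq, mul_smul, one_smul]; abel
    rw [this, smul_smul, inv_mul_cancel₀ hu, one_smul]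
  have h2 : u • (1 : Matrix D D K) - (Tᵀ * S - J) =
      (u • (1 : Matrix D D K) + J) * (1 - (N * Tᵀ) * S) := by
    rw [Matrix.mul_sub, Matrix.mul_one, Matrix.mul_assoc N, ← Matrix.mul_assoc _ N, h1,
      Matrix.one_mul]
    abel
  have h3 : (u ^ 2 - 1) • (1 - S * (N * Tᵀ)) =
      (u ^ 2 - 1) • (1 : Matrix V V K) - (u • (S * Tᵀ) - T * Tᵀ) := by
    rw [smul_sub, hN]
    simp only [Matrix.smul_mul, Matrix.mul_smul, smul_smul, mul_inv_cancel₀ hu, one_smul,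
      Matrix.sub_mul, Matrix.mul_sub, Matrix.one_mul]
    rw [← Matrix.mul_assoc, hS]
  rw [h2, det_mul, det_one_sub_mul_comm, ← h3, det_smul]
  ring

/-- Conjugation by `Δ` gives `det (u + J) = det (u - J)`, and the product of the two matrices is the
scalar `u² - 1`. -/
theorem det_smul_one_add_involution_sq (J Δ : Matrix D D K) (hJ : J * J = 1) (hΔ : Δ * Δ = 1)
    (hconj : Δ * J * Δ = -J) (u : K) :
    (u • (1 : Matrix D D K) + J).det ^ 2 = (u ^ 2 - 1) ^ Fintype.card D := by
  have h1 : (u • (1 : Matrix D D K) - J).det = (u • (1 : Matrix D D K) + J).det := by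
    have : u • (1 : Matrix D D K) - J = Δ * (u • 1 + J) * Δ := by
      rw [Matrix.mul_add, Matrix.add_mul, hconj, Matrix.mul_smul, Matrix.smul_mul, Matrix.mul_one,
        hΔ, sub_eq_add_neg]
    have hd : Δ.det * Δ.det = 1 := by rw [← det_mul, hΔ, det_one]
    rw [this, det_mul, det_mul]
    linear_combination (u • (1 : Matrix D D K) + J).det * hd
  have h2 : (u • (1 : Matrix D D K) + J) * (u • 1 - J) = (u ^ 2 - 1) • 1 := by
    rw [Matrix.add_mul, Matrix.mul_sub, Matrix.mul_sub]
    simp only [Matrix.smul_mul, Matrix.mul_smul, Matrix.one_mul, Matrix.mul_one, hJ]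
    rw [sub_smul, sq, mul_smul, one_smul]; abel
  rw [sq]
  nth_rewrite 2 [← h1]
  rw [← det_mul, h2, det_smul, det_one, mul_one]

/-- A Schur complement without division: a block triangular right factor clears the upper right
block at the cost of `a ^ |W|`, so `a = 0` is allowed. -/
theorem det_fromBlocks_smul_one {U W : Type*} [Fintype U] [DecidableEq U] [Fintype W]
    [DecidableEq W] (a d : K) (B : Matrix U W K) (C : Matrix W U K) :
    (fromBlocks (a • (1 : Matrix U U K)) B C (d • (1 : Matrix W W K))).det *
        a ^ Fintype.card W =
      a ^ Fintype.card U * ((a * d) • (1 : Matrix W W K) - C * B).det := by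
  have h : fromBlocks (a • (1 : Matrix U U K)) B C (d • (1 : Matrix W W K)) *
      fromBlocks (1 : Matrix U U K) (-B) 0 (a • (1 : Matrix W W K)) =
      fromBlocks (a • 1) 0 C ((a * d) • (1 : Matrix W W K) - C * B) := by
    rw [fromBlocks_multiply]
    congr 1
    · simp
    · simp
    · simp
    · simp [smul_smul, sub_eq_add_neg, add_comm]
  have h' := congrArg det h
  rw [det_mul, det_fromBlocks_zero₂₁, det_fromBlocks_zero₁₂, det_one, one_mul, det_smul, det_one,
    mul_one, det_smul, det_one, mul_one] at h'
  exact h'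

end Determinants

end

end CycleCount

namespace CycleCount

section

open Matrix

/-! ### Traces of powers as counts of cyclic sequences -/

section TraceExpansion

variable {K D : Type*} [CommRing K] [Fintype D] [DecidableEq D]

theorem pow_mul_apply_eq_sum (B C : Matrix D D K) (n : ℕ) (a b : D) :
    (B ^ n * C) a b = ∑ s : Fin n → D,
      (∏ i : Fin n, B ((Fin.cons a s : Fin (n + 1) → D) i.castSucc) (s i)) *
        C ((Fin.cons a s : Fin (n + 1) → D) (Fin.last n)) b := by
  induction n generalizing a with
  | zero => simp
  | succ n ih =>
    rw [pow_succ', Matrix.mul_assoc, Matrix.mul_apply,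
      ← (Fin.consEquiv (fun _ : Fin (n + 1) => D)).sum_comp, Fintype.sum_prod_type]
    refine Finset.sum_congr rfl fun c _ => ?_
    rw [ih, Finset.mul_sum]
    refine Finset.sum_congr rfl fun s _ => ?_
    rw [Fin.prod_univ_succ, ← mul_assoc, ← Fin.succ_last]
    simp only [Fin.consEquiv_apply, Fin.cons_succ, Fin.cons_zero, Fin.castSucc_zero,
      ← Fin.succ_castSucc]

theorem trace_pow_succ_eq_sum (B : Matrix D D K) (n : ℕ) :
    (B ^ (n + 1)).trace = ∑ t : Fin (n + 1) → D, ∏ i, B (t i) (t (i + 1)) := by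
  rw [pow_succ, Matrix.trace, ← (Fin.consEquiv (fun _ : Fin (n + 1) => D)).sum_comp,
    Fintype.sum_prod_type]
  refine Finset.sum_congr rfl fun a _ => ?_
  rw [Matrix.diag_apply, pow_mul_apply_eq_sum]
  refine Finset.sum_congr rfl fun s _ => ?_
  rw [Fin.prod_univ_castSucc]
  simp [Fin.consEquiv_apply]

theorem trace_pow_eq_card (r : D → D → Prop) [DecidableRel r] (L : ℕ) [NeZero L] :
    ((Matrix.of fun d e => if r d e then (1 : K) else 0) ^ L).trace =
      (Nat.card {t : ZMod L → D // ∀ i, r (t i) (t (i + 1))} : K) := by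
  classical
  -- For `L = n + 1` the type `ZMod L` is `Fin (n + 1)` by definition, with the same cyclic
  -- addition.
  obtain ⟨n, rfl⟩ := Nat.exists_eq_succ_of_ne_zero (NeZero.ne L)
  rw [Nat.succ_eq_add_one, trace_pow_succ_eq_sum, Nat.card_eq_fintype_card, Fintype.card_subtype,
    ← Finset.sum_boole]
  refine Finset.sum_congr rfl fun t _ => ?_
  simp only [Matrix.of_apply, Finset.prod_ite_zero, Finset.prod_const_one, Finset.mem_univ,
    true_implies]
  split_ifs with h1 h2 h2
  · rfl
  · exact (h2 h1).elim
  · exact (h1 h2).elim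
  · rfl

end TraceExpansion

/-! ### Closed non-backtracking sequences and cycles -/

section ClosedSequences

variable {V : Type*} (G : SimpleGraph V)

/-- A closed non-backtracking sequence of vertices, indexed cyclically. -/
def IsClosedNonbacktracking {L : ℕ} (f : ZMod L → V) : Prop :=
  ∀ i, G.Adj (f i) (f (i + 1)) ∧ f i ≠ f (i + 2)

/-- The relation of two darts being consecutive in a non-backtracking walk. -/
def Follows (d e : G.Dart) : Prop := d.snd = e.fst ∧ d.fst ≠ e.snd

instance [DecidableEq V] : DecidableRel (Follows G) :=
  fun d e => inferInstanceAs (Decidable (d.snd = e.fst ∧ d.fst ≠ e.snd))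

/-- Closed sequences of consecutive darts are closed non-backtracking sequences of vertices. -/
def dartSequenceEquiv (L : ℕ) :
    {t : ZMod L → G.Dart // ∀ i, Follows G (t i) (t (i + 1))} ≃
      {f : ZMod L → V // IsClosedNonbacktracking G f} where
  toFun t := ⟨fun i => (t.1 i).fst, fun i => by
    have h0 := (t.1 i).adj
    rw [(t.2 i).1] at h0
    refine ⟨h0, ?_⟩
    have h1 := (t.2 i).2
    rwa [(t.2 (i + 1)).1, add_assoc, one_add_one_eq_two] at h1⟩
  invFun f := ⟨fun i => ⟨(f.1 i, f.1 (i + 1)), (f.2 i).1⟩, fun i => ⟨rfl, by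
    have h := (f.2 i).2
    simpa only [add_assoc, one_add_one_eq_two] using h⟩⟩
  left_inv t := by
    ext i
    · rfl
    · exact (t.2 i).1.symm
  right_inv f := rfl

variable {G}

/-- The walk along a sequence of successively adjacent vertices. -/
def sequenceWalk (g : ℕ → V) (h : ∀ i, G.Adj (g i) (g (i + 1))) : ∀ n, G.Walk (g 0) (g n)
  | 0 => .nil
  | n + 1 => .cons (h 0) (sequenceWalk (fun i => g (i + 1)) (fun i => h (i + 1)) n)

theorem length_sequenceWalk (g : ℕ → V) (h : ∀ i, G.Adj (g i) (g (i + 1))) (n : ℕ) :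
    (sequenceWalk g h n).length = n := by
  induction n generalizing g with
  | zero => rfl
  | succ n ih => exact congrArg (· + 1) (ih _ _)

theorem getVert_sequenceWalk (g : ℕ → V) (h : ∀ i, G.Adj (g i) (g (i + 1))) {n i : ℕ}
    (hi : i ≤ n) : (sequenceWalk g h n).getVert i = g i := by
  induction n generalizing g i with
  | zero => obtain rfl : i = 0 := by omega
            rfl
  | succ n ih =>
    cases i with
    | zero => simp
    | succ i => exact ih _ _ (by omega)

theorem isCycle_of_getVert_injOn {u : V} (p : G.Walk u u) (hp : 3 ≤ p.length)
    (hinj : Set.InjOn p.getVert {i | i < p.length}) : p.IsCycle := by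
  rw [SimpleGraph.Walk.isCycle_iff_isPath_tail_and_le_length]
  refine ⟨?_, hp⟩
  have hnil : ¬ p.Nil := by rw [SimpleGraph.Walk.not_nil_iff_lt_length]; omega
  have hlen := SimpleGraph.Walk.length_tail_add_one hnil
  rw [← SimpleGraph.Walk.IsPath.getVert_injOn_iff]
  have h0 : p.getVert p.length = p.getVert 0 := by simp
  intro i hi j hj hij
  rw [Set.mem_ofPred_eq] at hi hj
  rw [SimpleGraph.Walk.getVert_tail, SimpleGraph.Walk.getVert_tail] at hij
  -- The last vertex of the tail is the base point, so its index is replaced by `0` to stay in the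
  -- range of `hinj`.
  by_cases hi' : i + 1 = p.length <;> by_cases hj' : j + 1 = p.length
  · omega
  · rw [hi', h0] at hij
    have := hinj (show 0 < p.length by omega) (show j + 1 < p.length by omega) hij
    omega
  · rw [hj', h0] at hij
    have := hinj (show i + 1 < p.length by omega) (show 0 < p.length by omega) hij
    omega
  · have := hinj (show i + 1 < p.length by omega) (show j + 1 < p.length by omega) hij
    omega

theorem exists_isCycle_of_sequence (g : ℕ → V) (h : ∀ i, G.Adj (g i) (g (i + 1))) {n : ℕ}
    (hn : 3 ≤ n) (hclosed : g n = g 0) (hinj : Set.InjOn g {i | i < n}) :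
    ∃ p : G.Walk (g 0) (g 0), p.IsCycle ∧ p.length = n ∧ ∀ i ≤ n, p.getVert i = g i := by
  -- The endpoint is generalized so that `g n = g 0` can be substituted into the type of the walk.
  have key : ∀ (v : V) (q : G.Walk (g 0) v), v = g 0 → q.length = n →
      (∀ i ≤ n, q.getVert i = g i) →
      ∃ p : G.Walk (g 0) (g 0), p.IsCycle ∧ p.length = n ∧ ∀ i ≤ n, p.getVert i = g i := by
    rintro v q rfl hl hv
    refine ⟨q, isCycle_of_getVert_injOn q (hl ▸ hn) ?_, hl, hv⟩
    intro i hi j hj hij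
    rw [Set.mem_ofPred_eq, hl] at hi hj
    exact hinj hi hj (by rw [← hv i hi.le, ← hv j hj.le, hij])
  exact key _ (sequenceWalk g h n) hclosed (length_sequenceWalk g h n)
    fun i hi => getVert_sequenceWalk g h hi

/-- A non-backtracking walk that returns to a vertex after `l` steps bounds the girth. -/
theorem girth_le_of_nonbacktracking (g : ℕ → V)
    (h : ∀ i, G.Adj (g i) (g (i + 1)) ∧ g i ≠ g (i + 2)) {l : ℕ} (hl : 0 < l) {a : ℕ}
    (ha : g (a + l) = g a) : G.girth ≤ l := by
  classical
  -- A shortest return has no repetition inside; lengths 1 and 2 are excluded by adjacency and by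
  -- non-backtracking, so it is a cycle.
  have hex : ∃ l, 0 < l ∧ ∃ a, g (a + l) = g a := ⟨l, hl, a, ha⟩
  obtain ⟨hpos, b, hb⟩ := Nat.find_spec hex
  have hmin := fun m (hm : m < Nat.find hex) => Nat.find_min hex hm
  have hle : Nat.find hex ≤ l := Nat.find_min' hex ⟨hl, a, ha⟩
  set n := Nat.find hex
  have h1 : n ≠ 1 := fun h1 => (h b).1.ne (by rw [h1] at hb; exact hb.symm)
  have h2 : n ≠ 2 := fun h2 => (h b).2 (by rw [h2] at hb; exact hb.symm)
  obtain ⟨p, hp, hpl, -⟩ := exists_isCycle_of_sequence (fun i => g (b + i)) (fun i => (h (b + i)).1)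
    (n := n) (by omega) hb (by
      have aux : ∀ i j, i < j → j < n → g (b + i) ≠ g (b + j) := by
        intro i j hij hj he
        refine hmin (j - i) (by omega) ⟨by omega, b + i, ?_⟩
        rw [he]; congr 1; omega
      intro i hi j hj hij
      rcases lt_trichotomy i j with hlt | heq | hgt
      · exact (aux i j hlt hj hij).elim
      · exact heq
      · exact (aux j i hgt hi hij.symm).elim)
  exact (SimpleGraph.girth_le_length hp).trans (hpl ▸ hle)

/-- Below twice the girth, closed non-backtracking sequences have no repeated vertex. -/
theorem IsClosedNonbacktracking.injective {L : ℕ} [NeZero L] {f : ZMod L → V}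
    (hf : IsClosedNonbacktracking G f) (hL : L < 2 * G.girth) : Function.Injective f := by
  set g : ℕ → V := fun i => f i
  have hg : ∀ i, G.Adj (g i) (g (i + 1)) ∧ g i ≠ g (i + 2) := fun i => by
    simpa [g] using hf i
  -- A repetition leaves two closed arcs, of lengths `j - i` and `L - (j - i)`, each at least the
  -- girth.
  have aux : ∀ i j : ℕ, i < j → j < L → g i ≠ g j := by
    intro i j hij hj he
    have h1 : G.girth ≤ j - i := girth_le_of_nonbacktracking g hg (a := i) (by omega) (by
      rw [he]; congr 1; omega)
    have h2 : G.girth ≤ L - (j - i) := girth_le_of_nonbacktracking g hg (a := j) (by omega) (by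
      rw [← he, show j + (L - (j - i)) = i + L by omega]
      simp [g])
    omega
  intro x y hxy
  have hx : g x.val = f x := by simp [g]
  have hy : g y.val = f y := by simp [g]
  rw [← hx, ← hy] at hxy
  rcases lt_trichotomy x.val y.val with hlt | heq | hgt
  · exact (aux _ _ hlt (ZMod.val_lt y) hxy).elim
  · exact ZMod.val_injective L heq
  · exact (aux _ _ hgt (ZMod.val_lt x) hxy.symm).elim

/-- The subgraph traced by a closed sequence of successively adjacent vertices. -/
def cycleSubgraph {L : ℕ} (f : ZMod L → V) (hf : ∀ i, G.Adj (f i) (f (i + 1))) : G.Subgraph where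
  verts := Set.range f
  Adj x y := ∃ i, s(f i, f (i + 1)) = s(x, y)
  adj_sub := by
    rintro x y ⟨i, hi⟩
    rw [← SimpleGraph.mem_edgeSet, ← hi, SimpleGraph.mem_edgeSet]
    exact hf i
  edge_vert := by
    rintro x y ⟨i, hi⟩
    rcases Sym2.eq_iff.1 hi with ⟨rfl, -⟩ | ⟨-, rfl⟩ <;> exact ⟨_, rfl⟩
  symm := by
    constructor
    rintro x y ⟨i, hi⟩
    exact ⟨i, hi.trans Sym2.eq_swap⟩

theorem toSubgraph_eq_cycleSubgraph {L : ℕ} [NeZero L] {f : ZMod L → V}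
    (hf : ∀ i, G.Adj (f i) (f (i + 1))) {u : V} (p : G.Walk u u) (hl : p.length = L)
    (hp : ∀ i ≤ L, p.getVert i = f i) : p.toSubgraph = cycleSubgraph f hf := by
  refine SimpleGraph.Subgraph.ext ?_ ?_
  · ext x
    rw [SimpleGraph.Walk.mem_verts_toSubgraph, SimpleGraph.Walk.mem_support_iff_exists_getVert]
    constructor
    · rintro ⟨n, rfl, hn⟩
      exact ⟨n, (hp n (hl ▸ hn)).symm⟩
    · rintro ⟨i, rfl⟩
      exact ⟨i.val, by rw [hp _ (ZMod.val_lt i).le]; simp, hl ▸ (ZMod.val_lt i).le⟩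
  · ext x y
    rw [SimpleGraph.Walk.toSubgraph_adj_iff]
    constructor
    · rintro ⟨n, hn, hlt⟩
      refine ⟨n, ?_⟩
      rw [← hn, hp n (by omega), hp (n + 1) (by omega)]
      simp
    · rintro ⟨i, hi⟩
      have := ZMod.val_lt i
      refine ⟨i.val, ?_, by omega⟩
      rw [← hi, hp _ (by omega), hp _ (by omega)]
      simp

variable (G) in
/-- Injective closed sequences of successively adjacent vertices. -/
def CyclicSequence (L : ℕ) : Type _ :=
  {f : ZMod L → V // (∀ i, G.Adj (f i) (f (i + 1))) ∧ Function.Injective f}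

theorem exists_isCycle_iff_exists_cyclicSequence {L : ℕ} [NeZero L] (hL : 3 ≤ L)
    (C : G.Subgraph) :
    (∃ (v : V) (p : G.Walk v v), p.IsCycle ∧ p.length = L ∧ p.toSubgraph = C) ↔
      ∃ f : CyclicSequence G L, cycleSubgraph f.1 f.2.1 = C := by
  constructor
  · rintro ⟨v, p, hp, hl, rfl⟩
    set f : ZMod L → V := fun i => p.getVert i.val with hfdef
    have hv : ∀ n ≤ L, p.getVert n = f n := by
      intro n hn
      rcases hn.lt_or_eq with hlt | rfl
      · simp [f, ZMod.val_natCast_of_lt hlt]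
      · simp [f, ← hl]
    have hadj : ∀ i, G.Adj (f i) (f (i + 1)) := by
      intro i
      have hi := ZMod.val_lt i
      have h := p.adj_getVert_succ (show i.val < p.length by omega)
      rw [hv _ (by omega), hv _ (by omega)] at h
      simpa using h
    refine ⟨⟨f, hadj, ?_⟩, (toSubgraph_eq_cycleSubgraph hadj p hl hv).symm⟩
    intro x y hxy
    have hx := ZMod.val_lt x
    have hy := ZMod.val_lt y
    exact ZMod.val_injective L (hp.getVert_injOn' (by rw [Set.mem_ofPred_eq]; omega)
      (by rw [Set.mem_ofPred_eq]; omega) hxy)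
  · rintro ⟨⟨f, hadj, hinj⟩, rfl⟩
    obtain ⟨p, hp, hl, hv⟩ := exists_isCycle_of_sequence (fun i : ℕ => f i)
      (fun i => by simpa using hadj i) hL (by simp) (by
        intro i hi j hj hij
        have := congrArg ZMod.val (hinj hij)
        rwa [ZMod.val_natCast_of_lt hi, ZMod.val_natCast_of_lt hj] at this)
    exact ⟨_, p, hp, hl, toSubgraph_eq_cycleSubgraph hadj p hl hv⟩

/-- The sign `1` or `-1` of a direction of travel. -/
def directionSign (L : ℕ) (b : Bool) : ZMod L := if b then 1 else -1

theorem directionSign_mul_self {L : ℕ} (b : Bool) : directionSign L b * directionSign L b = 1 := by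
  cases b <;> simp [directionSign]

/-- Change of base point and direction of a cyclic sequence. -/
def CyclicSequence.rotate {L : ℕ} (f : CyclicSequence G L) (a : ZMod L) (b : Bool) :
    CyclicSequence G L :=
  ⟨fun i => f.1 (a + directionSign L b * i), by
    constructor
    · intro i
      cases b
      · have h := (f.2.1 (a - i - 1)).symm
        convert h using 2 <;> simp [directionSign] <;> ring_nf
      · have h := f.2.1 (a + i)
        convert h using 2 <;> simp [directionSign] <;> ring_nf
    · intro i j hij
      have h := congrArg (directionSign L b * ·) (add_left_cancel (f.2.2 hij))
      simpa only [← mul_assoc, directionSign_mul_self, one_mul] using h⟩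

theorem CyclicSequence.cycleSubgraph_rotate {L : ℕ} (f : CyclicSequence G L) (a : ZMod L)
    (b : Bool) :
    cycleSubgraph (f.rotate a b).1 (f.rotate a b).2.1 = cycleSubgraph f.1 f.2.1 := by
  have hsurj : ∀ j, ∃ i, a + directionSign L b * i = j := fun j =>
    ⟨directionSign L b * (j - a), by rw [← mul_assoc, directionSign_mul_self]; ring⟩
  refine SimpleGraph.Subgraph.ext ?_ ?_
  · ext x
    constructor
    · rintro ⟨i, rfl⟩
      exact ⟨_, rfl⟩
    · rintro ⟨j, rfl⟩
      obtain ⟨i, rfl⟩ := hsurj j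
      exact ⟨i, rfl⟩
  · ext x y
    cases b
    · constructor
      · rintro ⟨i, hi⟩
        refine ⟨a - i - 1, ?_⟩
        rw [← hi, Sym2.eq_swap]
        simp only [CyclicSequence.rotate, directionSign]
        congr 3 <;> simp <;> ring_nf
      · rintro ⟨i, hi⟩
        refine ⟨a - i - 1, ?_⟩
        rw [← hi, Sym2.eq_swap]
        simp only [CyclicSequence.rotate, directionSign]
        congr 3 <;> simp <;> ring_nf
    · constructor
      · rintro ⟨i, hi⟩
        refine ⟨a + i, ?_⟩
        rw [← hi]
        simp only [CyclicSequence.rotate, directionSign]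
        congr 3 <;> simp <;> ring_nf
      · rintro ⟨i, hi⟩
        refine ⟨i - a, ?_⟩
        rw [← hi]
        simp only [CyclicSequence.rotate, directionSign]
        congr 3 <;> simp <;> ring_nf

theorem zmod_two_ne_zero {L : ℕ} (hL : 3 ≤ L) : (2 : ZMod L) ≠ 0 := by
  intro h
  have h2 : ((2 : ℕ) : ZMod L) = 0 := by exact_mod_cast h
  have := Nat.le_of_dvd two_pos ((ZMod.natCast_eq_zero_iff 2 L).1 h2)
  omega

/-- The first edge of `g` fixes the base point and direction along `f`. The direction never changes
later: a turn would give `g (n + 2) = g n`, hence `2 = 0` in `ZMod L`. -/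
theorem CyclicSequence.exists_rotate_eq {L : ℕ} [NeZero L] (hL : 3 ≤ L) (f g : CyclicSequence G L)
    (h : cycleSubgraph g.1 g.2.1 = cycleSubgraph f.1 f.2.1) : ∃ a b, f.rotate a b = g := by
  have hstep : ∀ i, ∃ j b, g.1 i = f.1 j ∧ g.1 (i + 1) = f.1 (j + directionSign L b) := by
    intro i
    have hi : (cycleSubgraph g.1 g.2.1).Adj (g.1 i) (g.1 (i + 1)) := ⟨i, rfl⟩
    rw [h] at hi
    obtain ⟨j, hj⟩ := hi
    rcases Sym2.eq_iff.1 hj with ⟨h1, h2⟩ | ⟨h1, h2⟩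
    · exact ⟨j, true, h1.symm, by simpa [directionSign] using h2.symm⟩
    · exact ⟨j + 1, false, h2.symm, by simpa [directionSign] using h1.symm⟩
  obtain ⟨a, b, h0, h1⟩ := hstep 0
  have hnat : ∀ n : ℕ, g.1 n = f.1 (a + directionSign L b * n) ∧
      g.1 ((n : ZMod L) + 1) = f.1 (a + directionSign L b * (n + 1)) := by
    intro n
    induction n with
    | zero => simpa using ⟨h0, by simpa using h1⟩
    | succ n ih =>
      push_cast
      refine ⟨ih.2, ?_⟩
      obtain ⟨j, c, hj, hj'⟩ := hstep ((n : ZMod L) + 1)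
      have hja := f.2.2 (hj.symm.trans ih.2)
      rw [hj', hja]
      by_cases hbc : b = c
      · subst hbc; ring_nf
      · exfalso
        have hs : directionSign L c = - directionSign L b := by
          cases b <;> cases c <;> simp_all [directionSign]
        rw [hja, hs, show a + directionSign L b * (n + 1) + -directionSign L b =
          a + directionSign L b * n by ring, ← ih.1] at hj'
        have := g.2.2 hj'
        apply zmod_two_ne_zero hL
        linear_combination this
  refine ⟨a, b, Subtype.ext (funext fun i => ?_)⟩
  have := (hnat i.val).1
  rw [ZMod.natCast_zmod_val] at this
  exact this.symm

theorem CyclicSequence.rotate_injective {L : ℕ} (hL : 3 ≤ L) (f : CyclicSequence G L)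
    {a a' : ZMod L} {b b' : Bool} (h : f.rotate a b = f.rotate a' b') : a = a' ∧ b = b' := by
  have h' : ∀ i, a + directionSign L b * i = a' + directionSign L b' * i := fun i =>
    f.2.2 (congrFun (congrArg Subtype.val h) i)
  have ha : a = a' := by simpa using h' 0
  refine ⟨ha, ?_⟩
  have hb : directionSign L b = directionSign L b' := by simpa [ha] using h' 1
  by_contra hne
  apply zmod_two_ne_zero hL
  cases b <;> cases b'
  · exact (hne rfl).elim
  · have h1 : (-1 : ZMod L) = 1 := hb
    linear_combination -h1
  · have h1 : (1 : ZMod L) = -1 := hb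
    linear_combination h1
  · exact (hne rfl).elim

/-- After a representative is chosen for each cycle, every cyclic sequence is a unique rotation of
one of them, by `L` base points and two directions. -/
theorem card_cyclicSequence {L : ℕ} [NeZero L] (hL : 3 ≤ L) :
    Nat.card (CyclicSequence G L) = 2 * L * numCycles G L := by
  set S : Set G.Subgraph := {C | ∃ (v : V) (p : G.Walk v v),
    p.IsCycle ∧ p.length = L ∧ p.toSubgraph = C} with hS
  have hrep : ∀ C : S, ∃ f : CyclicSequence G L, cycleSubgraph f.1 f.2.1 = C.1 := fun C =>
    (exists_isCycle_iff_exists_cyclicSequence hL C.1).1 C.2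
  choose rep hrep using hrep
  have hbij : Function.Bijective
      fun x : S × (ZMod L × Bool) => (rep x.1).rotate x.2.1 x.2.2 := by
    constructor
    · rintro ⟨C, a, b⟩ ⟨C', a', b'⟩ h
      have hC : C = C' := by
        apply Subtype.ext
        rw [← hrep C, ← hrep C', ← (rep C).cycleSubgraph_rotate a b,
          ← (rep C').cycleSubgraph_rotate a' b']
        congr 2
      subst hC
      obtain ⟨rfl, rfl⟩ := CyclicSequence.rotate_injective hL _ h
      rfl
    · intro g
      set C : S := ⟨cycleSubgraph g.1 g.2.1,
        (exists_isCycle_iff_exists_cyclicSequence hL _).2 ⟨g, rfl⟩⟩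
      obtain ⟨a, b, h⟩ := CyclicSequence.exists_rotate_eq hL (rep C) g (hrep C).symm
      exact ⟨⟨C, a, b⟩, h⟩
  rw [← Nat.card_congr (Equiv.ofBijective _ hbij), Nat.card_prod, Nat.card_prod, Nat.card_zmod,
    Nat.card_eq_fintype_card (α := Bool), Fintype.card_bool, Nat.card_coe_set_eq]
  change S.ncard * (L * 2) = 2 * L * S.ncard
  ring

theorem card_isClosedNonbacktracking {k : ℕ} (hk : 1 ≤ k) (hg : k < G.girth) :
    Nat.card {f : ZMod (2 * k) → V // IsClosedNonbacktracking G f} =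
      4 * k * numCycles G (2 * k) := by
  have : NeZero (2 * k) := ⟨by omega⟩
  -- Length 2 is degenerate: `i + 2 = i` in `ZMod 2`, so both counts are zero.
  rcases hk.eq_or_lt with rfl | hk
  · have hE : IsEmpty {f : ZMod (2 * 1) → V // IsClosedNonbacktracking G f} := by
      refine ⟨fun f => (f.2 0).2 ?_⟩
      rfl
    have hS : {C : G.Subgraph | ∃ (v : V) (p : G.Walk v v),
        p.IsCycle ∧ p.length = 2 * 1 ∧ p.toSubgraph = C} = ∅ := by
      refine Set.eq_empty_of_forall_notMem ?_
      rintro C ⟨v, p, hp, hl, -⟩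
      have := hp.three_le_length
      omega
    rw [Nat.card_of_isEmpty, numCycles, hS, Set.ncard_empty, mul_zero]
  · have hL : 3 ≤ 2 * k := by omega
    rw [show 4 * k = 2 * (2 * k) by ring, ← card_cyclicSequence hL]
    refine Nat.card_congr (Equiv.subtypeEquivRight fun f => ⟨fun hf => ?_, fun hf i => ?_⟩)
    · exact ⟨fun i => (hf i).1, hf.injective (by omega)⟩
    · refine ⟨hf.1 i, fun h => zmod_two_ne_zero hL ?_⟩
      linear_combination -hf.2 h

end ClosedSequences

end

end CycleCount

namespace CycleCount

section

open Polynomial Matrix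

/-! ### Incidence, reversal and non-backtracking matrices -/

section DartMatrices

variable {V : Type*} [Fintype V] [DecidableEq V] (G : SimpleGraph V) [DecidableRel G.Adj]
  (K : Type*) [Field K]

/-- Incidence matrix of vertices and darts starting there. -/
def startMatrix : Matrix V G.Dart K := Matrix.of fun v d => if d.fst = v then 1 else 0

/-- Incidence matrix of vertices and darts ending there. -/
def endMatrix : Matrix V G.Dart K := Matrix.of fun v d => if d.snd = v then 1 else 0

/-- The permutation matrix of the reversal of darts. -/
def reversalMatrix : Matrix G.Dart G.Dart K := Matrix.of fun d e => if d.symm = e then 1 else 0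

/-- The non-backtracking (Hashimoto) matrix. -/
def nonbacktrackingMatrix : Matrix G.Dart G.Dart K :=
  Matrix.of fun d e => if Follows G d e then 1 else 0

theorem reversalMatrix_transpose : (reversalMatrix G K)ᵀ = reversalMatrix G K := by
  ext d e
  have : e.symm = d ↔ d.symm = e :=
    ⟨fun h => by rw [← h, SimpleGraph.Dart.symm_symm], fun h => by
      rw [← h, SimpleGraph.Dart.symm_symm]⟩
  simp [reversalMatrix, this]

theorem reversalMatrix_mul_self : reversalMatrix G K * reversalMatrix G K = 1 := by
  nth_rewrite 2 [← reversalMatrix_transpose]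
  ext d e
  simp [reversalMatrix, Matrix.mul_apply, Matrix.one_apply,
    SimpleGraph.Dart.symm_involutive.injective.eq_iff, eq_comm]

theorem startMatrix_mul_reversalMatrix :
    startMatrix G K * reversalMatrix G K = endMatrix G K := by
  ext v e
  rw [← reversalMatrix_transpose]
  simp [startMatrix, endMatrix, reversalMatrix, Matrix.mul_apply]

theorem startMatrix_mul_endMatrix_transpose :
    startMatrix G K * (endMatrix G K)ᵀ = G.adjMatrix K := by
  ext v w
  simp only [startMatrix, endMatrix, Matrix.mul_apply, Matrix.of_apply, Matrix.transpose_apply,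
    SimpleGraph.adjMatrix_apply]
  split_ifs with h
  · rw [Finset.sum_eq_single (⟨(v, w), h⟩ : G.Dart)]
    · simp
    · intro d _ hd
      by_cases h1 : d.fst = v
      · by_cases h2 : d.snd = w
        · exact (hd (SimpleGraph.Dart.ext _ _ (Prod.ext h1 h2))).elim
        · simp [h2]
      · simp [h1]
    · simp
  · refine Finset.sum_eq_zero fun d _ => ?_
    by_cases h1 : d.fst = v
    · by_cases h2 : d.snd = w
      · exact (h (h1 ▸ h2 ▸ d.adj)).elim
      · simp [h2]
    · simp [h1]

theorem endMatrix_mul_transpose :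
    endMatrix G K * (endMatrix G K)ᵀ = Matrix.diagonal fun v => (G.degree v : K) := by
  have h : endMatrix G K * (endMatrix G K)ᵀ = startMatrix G K * (startMatrix G K)ᵀ := by
    rw [← startMatrix_mul_reversalMatrix, Matrix.transpose_mul, reversalMatrix_transpose,
      Matrix.mul_assoc, ← Matrix.mul_assoc (reversalMatrix G K), reversalMatrix_mul_self,
      Matrix.one_mul]
  rw [h]
  ext v w
  simp only [startMatrix, Matrix.mul_apply, Matrix.of_apply, Matrix.transpose_apply,
    Matrix.diagonal_apply]
  split_ifs with hvw
  · subst hvw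
    rw [← G.dart_fst_fiber_card_eq_degree v, ← Finset.sum_boole]
    exact Finset.sum_congr rfl fun d _ => by split_ifs <;> simp
  · refine Finset.sum_eq_zero fun d _ => ?_
    by_cases h1 : d.fst = v
    · have h2 : d.fst ≠ w := fun h2 => hvw (h1 ▸ h2)
      simp [h2]
    · simp [h1]

/-- Among the darts starting where `d` ends, only `d.symm` backtracks. -/
theorem endMatrix_transpose_mul_startMatrix_sub :
    (endMatrix G K)ᵀ * startMatrix G K - reversalMatrix G K = nonbacktrackingMatrix G K := by
  ext d e
  have h : ((endMatrix G K)ᵀ * startMatrix G K) d e = if d.snd = e.fst then 1 else 0 := by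
    simp [endMatrix, startMatrix, Matrix.mul_apply, eq_comm]
  rw [Matrix.sub_apply, h]
  simp only [reversalMatrix, nonbacktrackingMatrix, Follows, Matrix.of_apply]
  by_cases h1 : d.snd = e.fst
  · by_cases h2 : d.fst = e.snd
    · have : d.symm = e := SimpleGraph.Dart.ext _ _ (Prod.ext h1 h2)
      simp [h2, h1, this]
    · have : d.symm ≠ e := by
        rintro rfl
        exact h2 rfl
      simp [h2, h1, this]
  · have : d.symm ≠ e := by
      rintro rfl
      exact h1 rfl
    simp [h1, this]

variable {G}

/-- Reversal swaps the part in which a dart starts, so it anticommutes with the diagonal sign matrix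
recording that part. -/
theorem det_smul_one_add_reversalMatrix_sq {U W : Finset V}
    (hG : G.IsBipartiteWith (U : Set V) (W : Set V)) (u : K) :
    (u • (1 : Matrix G.Dart G.Dart K) + reversalMatrix G K).det ^ 2 =
      (u ^ 2 - 1) ^ (2 * G.edgeFinset.card) := by
  have hmem : ∀ d : G.Dart, (d.fst ∈ U ∧ d.snd ∉ U) ∨ (d.fst ∉ U ∧ d.snd ∈ U) := by
    intro d
    have hdisj : ∀ v, v ∈ U → v ∉ W := fun v h1 h2 =>
      Set.disjoint_left.1 hG.disjoint (Finset.mem_coe.2 h1) (Finset.mem_coe.2 h2)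
    rcases hG.mem_of_adj d.adj with ⟨h1, h2⟩ | ⟨h1, h2⟩
    · exact Or.inl ⟨h1, fun h => hdisj _ h h2⟩
    · exact Or.inr ⟨fun h => hdisj _ h h1, h2⟩
  rw [← G.dart_card_eq_twice_card_edges]
  refine det_smul_one_add_involution_sq (reversalMatrix G K)
    (Matrix.diagonal fun d : G.Dart => if d.fst ∈ U then (1 : K) else -1)
    (reversalMatrix_mul_self G K) ?_ ?_ u
  · rw [Matrix.diagonal_mul_diagonal, ← Matrix.diagonal_one]
    congr 1
    ext d
    split_ifs <;> simp
  · ext d e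
    rw [Matrix.mul_diagonal, Matrix.diagonal_mul]
    simp only [reversalMatrix, Matrix.of_apply, Matrix.neg_apply]
    by_cases h : d.symm = e
    · subst h
      rcases hmem d with ⟨h1, h2⟩ | ⟨h1, h2⟩ <;> simp [h1, h2]
    · simp [h]

end DartMatrices

/-! ### The spectrum of the non-backtracking matrix of a biregular graph -/

section Bipartite

variable {V : Type*} [Fintype V] [DecidableEq V] {G : SimpleGraph V} [DecidableRel G.Adj]
  {U W : Finset V} {q₁ q₂ : ℕ}

theorem not_adj_of_mem_left (hG : G.IsBipartiteWith (U : Set V) (W : Set V)) {x y : V}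
    (hx : x ∈ U) (hy : y ∈ U) : ¬ G.Adj x y := fun h => by
  have hdisj : ∀ v, v ∈ U → v ∉ W := fun v h1 h2 =>
    Set.disjoint_left.1 hG.disjoint (Finset.mem_coe.2 h1) (Finset.mem_coe.2 h2)
  rcases hG.mem_of_adj h with ⟨-, h2⟩ | ⟨h1, -⟩
  · exact hdisj _ hy h2
  · exact hdisj _ hx h1

/-- The vertices of a bipartite graph are the disjoint union of its parts. -/
noncomputable def partsEquiv (hUW : U ∪ W = Finset.univ)
    (hG : G.IsBipartiteWith (U : Set V) (W : Set V)) : U ⊕ W ≃ V :=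
  Equiv.ofBijective (Sum.elim Subtype.val Subtype.val) (by
    have hdisj : ∀ v, v ∈ U → v ∉ W := fun v h1 h2 =>
      Set.disjoint_left.1 hG.disjoint (Finset.mem_coe.2 h1) (Finset.mem_coe.2 h2)
    constructor
    · rintro (⟨x, hx⟩ | ⟨x, hx⟩) (⟨y, hy⟩ | ⟨y, hy⟩) h <;> simp only [Sum.elim_inl, Sum.elim_inr] at h
        <;> subst h
      · rfl
      · exact (hdisj _ hx hy).elim
      · exact (hdisj _ hy hx).elim
      · rfl
    · intro v
      have hv : v ∈ U ∪ W := hUW ▸ Finset.mem_univ v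
      rcases Finset.mem_union.1 hv with h | h
      · exact ⟨Sum.inl ⟨v, h⟩, rfl⟩
      · exact ⟨Sum.inr ⟨v, h⟩, rfl⟩)

theorem isHermitian_biadj_mul_transpose :
    (biadj G U W * (biadj G U W)ᵀ).IsHermitian := by
  rw [Matrix.IsHermitian, Matrix.conjTranspose_eq_transpose_of_trivial, Matrix.transpose_mul,
    Matrix.transpose_transpose]

theorem det_smul_one_sub_smul_of_isHermitian {n : Type*} [Fintype n] [DecidableEq n]
    {M : Matrix n n ℝ} (hM : M.IsHermitian) (c x : ℝ) (hx : x ≠ 0) :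
    (c • (1 : Matrix n n ℝ) - x • M).det = ∏ i, (c - x * hM.eigenvalues i) := by
  have h1 : c • (1 : Matrix n n ℝ) - x • M = x • (Matrix.scalar n (c / x) - M) := by
    rw [smul_sub, Matrix.scalar_apply, ← Matrix.smul_one_eq_diagonal, smul_smul,
      mul_div_cancel₀ _ hx]
  rw [h1, det_smul, ← Matrix.eval_charpoly, hM.charpoly_eq, eval_prod, ← Finset.card_univ,
    ← Finset.prod_const, ← Finset.prod_mul_distrib]
  refine Finset.prod_congr rfl fun i _ => ?_
  simp only [eval_sub, eval_X, eval_C, RCLike.ofReal_real_eq_id, id_eq]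
  field_simp

/-- Ordered by parts, the matrix has scalar diagonal blocks, by the constant degrees, and
off-diagonal blocks `-u Hᵀ` and `-u H`; its Schur complement involves only `H Hᵀ`. -/
theorem det_bass_bipartite (hUW : U ∪ W = Finset.univ)
    (hG : G.IsBipartiteWith (U : Set V) (W : Set V))
    (hU : ∀ u ∈ U, G.degree u = q₁ + 1) (hW : ∀ w ∈ W, G.degree w = q₂ + 1) (u : ℝ) (hu : u ≠ 0) :
    ((u ^ 2 - 1) • (1 : Matrix V V ℝ) -
        (u • G.adjMatrix ℝ - Matrix.diagonal fun v => (G.degree v : ℝ))).det *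
        (u ^ 2 + q₁) ^ W.card =
      (u ^ 2 + q₁) ^ U.card *
        ∏ i, ((u ^ 2 + q₁) * (u ^ 2 + q₂) -
          u ^ 2 * (isHermitian_biadj_mul_transpose (G := G) (U := U) (W := W)).eigenvalues i) := by
  set e := partsEquiv hUW hG
  have hblock : ((u ^ 2 - 1) • (1 : Matrix V V ℝ) -
        (u • G.adjMatrix ℝ - Matrix.diagonal fun v => (G.degree v : ℝ))).submatrix e e =
      fromBlocks ((u ^ 2 + q₁) • (1 : Matrix U U ℝ)) (-u • (biadj G U W)ᵀ) (-u • biadj G U W)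
        ((u ^ 2 + q₂) • (1 : Matrix W W ℝ)) := by
    have hl : ∀ i : U, e (Sum.inl i) = i.1 := fun _ => rfl
    have hr : ∀ i : W, e (Sum.inr i) = i.1 := fun _ => rfl
    ext (i | i) (j | j)
    · simp only [Matrix.submatrix_apply, Matrix.sub_apply, Matrix.smul_apply, fromBlocks_apply₁₁,
        hl, SimpleGraph.adjMatrix_apply, not_adj_of_mem_left hG i.2 j.2, Matrix.one_apply,
        Matrix.diagonal_apply, hU _ i.2, ← Subtype.ext_iff, if_false]
      split_ifs
      · simp only [smul_eq_mul]; push_cast; ring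
      · simp
    · have hne : i.1 ≠ j.1 := fun h => by
        have := e.injective (a₁ := Sum.inl i) (a₂ := Sum.inr j) h
        simp at this
      simp [hl, hr, biadj, hne, G.adj_comm]
    · have hne : i.1 ≠ j.1 := fun h => by
        have := e.injective (a₁ := Sum.inr i) (a₂ := Sum.inl j) h
        simp at this
      simp [hl, hr, biadj, hne]
    · simp only [Matrix.submatrix_apply, Matrix.sub_apply, Matrix.smul_apply, fromBlocks_apply₂₂,
        hr, SimpleGraph.adjMatrix_apply, not_adj_of_mem_left hG.symm i.2 j.2, Matrix.one_apply,
        Matrix.diagonal_apply, hW _ i.2, ← Subtype.ext_iff, if_false]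
      split_ifs
      · simp only [smul_eq_mul]; push_cast; ring
      · simp
  have hmul : (-u • biadj G U W) * (-u • (biadj G U W)ᵀ) =
      u ^ 2 • (biadj G U W * (biadj G U W)ᵀ) := by
    rw [Matrix.smul_mul, Matrix.mul_smul, smul_smul]
    congr 1
    ring
  rw [← det_submatrix_equiv_self e, hblock, ← Fintype.card_coe W, ← Fintype.card_coe U,
    det_fromBlocks_smul_one, hmul,
    det_smul_one_sub_smul_of_isHermitian isHermitian_biadj_mul_transpose _ _ (pow_ne_zero 2 hu)]

/-- The square appears because `det (u + J)` is known only up to sign. Factors kept on the left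
avoid division, and `expand` records that only `u²` occurs. -/
theorem charpoly_nonbacktrackingMatrix_sq (hUW : U ∪ W = Finset.univ)
    (hG : G.IsBipartiteWith (U : Set V) (W : Set V))
    (hU : ∀ u ∈ U, G.degree u = q₁ + 1) (hW : ∀ w ∈ W, G.degree w = q₂ + 1) :
    (nonbacktrackingMatrix G ℝ).charpoly ^ 2 *
        expand ℝ 2 ((X - C 1) ^ (2 * Fintype.card V) * (X + C (q₁ : ℝ)) ^ (2 * W.card)) =
      expand ℝ 2 ((X - C 1) ^ (2 * G.edgeFinset.card) * (X + C (q₁ : ℝ)) ^ (2 * U.card) *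
        (∏ i, (X ^ 2 - C
          ((isHermitian_biadj_mul_transpose (G := G) (U := U) (W := W)).eigenvalues i - (q₁ + q₂))
            * X + C ((q₁ : ℝ) * q₂))) ^ 2) := by
  -- For `u > 1` both `u` and `u² - 1` are nonzero, as the determinant identities require.
  refine Polynomial.eq_of_infinite_eval_eq _ _ ((Set.Ioi_infinite (1 : ℝ)).mono fun u hu => ?_)
  rw [Set.mem_Ioi] at hu
  rw [Set.mem_ofPred_eq]
  have hu0 : u ≠ 0 := by positivity
  have hu1 : u ^ 2 - 1 ≠ 0 := by nlinarith
  have h1 := det_smul_one_sub_nonbacktracking (startMatrix G ℝ) (endMatrix G ℝ)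
    (reversalMatrix G ℝ) (reversalMatrix_mul_self G ℝ) (startMatrix_mul_reversalMatrix G ℝ) u hu1
  rw [startMatrix_mul_endMatrix_transpose, endMatrix_mul_transpose,
    endMatrix_transpose_mul_startMatrix_sub] at h1
  have h2 := det_smul_one_add_reversalMatrix_sq ℝ hG u
  have h3 := det_bass_bipartite hUW hG hU hW u hu0
  have h4 : (nonbacktrackingMatrix G ℝ).charpoly.eval u =
      (u • (1 : Matrix G.Dart G.Dart ℝ) - nonbacktrackingMatrix G ℝ).det := by
    rw [Matrix.eval_charpoly, Matrix.scalar_apply, ← Matrix.smul_one_eq_diagonal]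
  have h5 : ∀ i, (u ^ 2) ^ 2 -
      ((isHermitian_biadj_mul_transpose (G := G) (U := U) (W := W)).eigenvalues i - (q₁ + q₂)) *
        u ^ 2 + (q₁ : ℝ) * q₂ = (u ^ 2 + q₁) * (u ^ 2 + q₂) -
          u ^ 2 * (isHermitian_biadj_mul_transpose (G := G) (U := U) (W := W)).eigenvalues i :=
    fun i => by ring
  simp only [eval_mul, eval_pow, expand_eval, eval_sub, eval_add, eval_X, eval_C, eval_prod, h4, h5]
  rw [← h2, pow_mul', pow_mul', pow_mul', ← mul_pow, ← mul_pow, ← mul_pow, ← mul_pow, ← mul_assoc,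
    h1, mul_assoc, h3]
  ring

/-- Over `ℂ` all roots are available, and taking `2k`-th power sums of roots turns the factorization
of the characteristic polynomial into a sum. -/
theorem trace_nonbacktrackingMatrix_pow (hUW : U ∪ W = Finset.univ)
    (hG : G.IsBipartiteWith (U : Set V) (W : Set V))
    (hU : ∀ u ∈ U, G.degree u = q₁ + 1) (hW : ∀ w ∈ W, G.degree w = q₂ + 1) (k : ℕ) :
    ((nonbacktrackingMatrix G ℂ) ^ (2 * k)).trace =
      ((2 * ((G.edgeFinset.card : ℝ) - Fintype.card V + (U.card - W.card) * (-(q₁ : ℝ)) ^ k +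
        ∑ i, newtonS ((q₁ : ℝ) * q₂)
          ((isHermitian_biadj_mul_transpose (G := G) (U := U) (W := W)).eigenvalues i - (q₁ + q₂))
            k) : ℝ) : ℂ) := by
  have hmap : (nonbacktrackingMatrix G ℝ).map Complex.ofRealHom = nonbacktrackingMatrix G ℂ := by
    ext d e
    simp only [nonbacktrackingMatrix, Matrix.map_apply, Matrix.of_apply]
    split_ifs <;> simp
  have h := congrArg (Polynomial.map Complex.ofRealHom)
    (charpoly_nonbacktrackingMatrix_sq hUW hG hU hW)
  rw [Polynomial.map_mul, Polynomial.map_pow, ← Matrix.charpoly_map, hmap, map_expand, map_expand]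
    at h
  simp only [Polynomial.map_mul, Polynomial.map_pow, Polynomial.map_sub, Polynomial.map_add,
    Polynomial.map_prod, Polynomial.map_X, Polynomial.map_C, Complex.ofRealHom_eq_coe] at h
  have hquad : ∀ p α : ℝ, (X ^ 2 - C (α : ℂ) * X + C (p : ℂ) : ℂ[X]) ≠ 0 := fun p α => by
    refine Polynomial.Monic.ne_zero ?_
    monicity!
  have h1 : ∀ (a : ℂ) j, (X - C a : ℂ[X]) ^ j ≠ 0 := fun a j => pow_ne_zero _ (X_sub_C_ne_zero a)
  have h2 : ∀ (a : ℂ) j, (X + C a : ℂ[X]) ^ j ≠ 0 := fun a j => pow_ne_zero _ (X_add_C_ne_zero a)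
  have h3 := fun s : Finset W => Finset.prod_ne_zero_iff.2 fun i (_ : i ∈ s) => hquad
    ((q₁ : ℝ) * q₂)
    ((isHermitian_biadj_mul_transpose (G := G) (U := U) (W := W)).eigenvalues i - (q₁ + q₂))
  have h' := congrArg (fun f => rootPowerSum f (2 * k)) h
  rw [rootPowerSum_mul (pow_ne_zero _ (Matrix.charpoly_monic _).ne_zero)
    ((expand_ne_zero two_pos).2 (mul_ne_zero (h1 _ _) (h2 _ _))), rootPowerSum_expand_two,
    rootPowerSum_expand_two, rootPowerSum_mul (h1 _ _) (h2 _ _),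
    rootPowerSum_mul (mul_ne_zero (h1 _ _) (h2 _ _)) (pow_ne_zero _ (h3 _)),
    rootPowerSum_mul (h1 _ _) (h2 _ _)] at h'
  simp only [rootPowerSum_pow] at h'
  rw [rootPowerSum_prod _ _ (fun i => hquad _ _)] at h'
  simp only [rootPowerSum_quadratic, rootPowerSum_X_sub_C, rootPowerSum_X_add_C] at h'
  rw [trace_pow_eq_sum_roots_charpoly]
  change rootPowerSum _ _ = _
  push_cast at h' ⊢
  simp only [one_pow] at h'
  linear_combination h' / 2

end Bipartite

end

end CycleCount

namespace CycleCount

/-! ### Coefficients of the recursion -/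

section NewtonCoeff

theorem newtonCoeff_eq_zero : ∀ {k i : ℕ}, k < 2 * i → newtonCoeff k i = 0
  | 0, i, h => by simp [newtonCoeff, show i ≠ 0 by omega]
  | 1, i, h => by simp [newtonCoeff, show i ≠ 0 by omega]
  | 2, i, h => by simp [newtonCoeff, show i ≠ 0 by omega, show i ≠ 1 by omega]
  | k + 3, 0, h => by omega
  | k + 3, i + 1, h => by
    rw [newtonCoeff, newtonCoeff_eq_zero (by omega), newtonCoeff_eq_zero (by omega)]

theorem newtonCoeff_zero_right : ∀ {k : ℕ}, 1 ≤ k → newtonCoeff k 0 = 1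
  | 1, _ => rfl
  | 2, _ => rfl
  | k + 3, _ => by rw [newtonCoeff]; exact newtonCoeff_zero_right (by omega)

theorem newtonCoeff_succ_succ {k : ℕ} (hk : 2 ≤ k) (i : ℕ) :
    newtonCoeff (k + 1) (i + 1) = newtonCoeff k (i + 1) + newtonCoeff (k - 1) i := by
  obtain ⟨j, rfl⟩ := Nat.exists_eq_add_of_le' hk
  rfl

theorem newtonCoeff_one_right {k : ℕ} (hk : 2 ≤ k) : newtonCoeff k 1 = k := by
  induction k, hk using Nat.le_induction with
  | base => rfl
  | succ k hk ih => rw [newtonCoeff_succ_succ hk, ih, newtonCoeff_zero_right (by omega)]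

theorem newtonCoeff_two_right {k : ℕ} (hk : 4 ≤ k) :
    (newtonCoeff k 2 : ℝ) = (k : ℝ) * ((k : ℝ) - 3) / 2 := by
  induction k, hk using Nat.le_induction with
  | base => norm_num [newtonCoeff]
  | succ k hk ih =>
    rw [newtonCoeff_succ_succ (by omega), newtonCoeff_one_right (by omega), Nat.cast_add, ih,
      Nat.cast_sub (by omega)]
    push_cast
    ring

theorem newtonCoeff_three_right {k : ℕ} (hk : 6 ≤ k) :
    (newtonCoeff k 3 : ℝ) = (k : ℝ) * ((k : ℝ) - 4) * ((k : ℝ) - 5) / 6 := by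
  induction k, hk using Nat.le_induction with
  | base => norm_num [newtonCoeff]
  | succ k hk ih =>
    rw [newtonCoeff_succ_succ (by omega), Nat.cast_add, ih, newtonCoeff_two_right (by omega),
      Nat.cast_sub (by omega)]
    push_cast
    ring

theorem sum_newtonCoeff_eq_newtonS (p α : ℝ) : ∀ (k N : ℕ), 1 ≤ k → k < 2 * N →
    ∑ i ∈ Finset.range N, (-1 : ℝ) ^ i * (newtonCoeff k i : ℝ) * p ^ i * α ^ (k - 2 * i) =
      newtonS p α k
  | 1, N + 1, _, _ => by
    rw [Finset.sum_range_succ']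
    simp [newtonCoeff, newtonS]
  | 2, N + 2, _, _ => by
    rw [Finset.sum_range_succ', Finset.sum_range_succ']
    simp [newtonCoeff, newtonS]
    ring
  | k + 3, N + 1, _, h => by
    rw [newtonS, ← sum_newtonCoeff_eq_newtonS p α (k + 2) (N + 1) (by omega) (by omega),
      ← sum_newtonCoeff_eq_newtonS p α (k + 1) N (by omega) (by omega),
      Finset.sum_range_succ', Finset.sum_range_succ', mul_add, Finset.mul_sum, Finset.mul_sum,
      add_sub_right_comm, ← Finset.sum_sub_distrib]
    congr 1
    · refine Finset.sum_congr rfl fun i _ => ?_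
      have hα : (newtonCoeff (k + 2) (i + 1) : ℝ) * α ^ (k + 1 - 2 * i) =
          newtonCoeff (k + 2) (i + 1) * (α * α ^ (k + 2 - 2 * (i + 1))) := by
        -- Where the truncated exponents would disagree, the coefficient vanishes.
        by_cases hi : 2 * i ≤ k
        · rw [← pow_succ']
          congr 2
          omega
        · rw [newtonCoeff_eq_zero (by omega)]
          simp
      rw [newtonCoeff, show k + 3 - 2 * (i + 1) = k + 1 - 2 * i by omega]
      push_cast
      linear_combination (-1) ^ (i + 1) * p ^ (i + 1) * hα
    · rw [newtonCoeff]
      simp only [mul_zero, Nat.sub_zero]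
      ring

/-- This evaluates the contribution of the zero eigenvalues of `H Hᵀ`. -/
theorem newtonS_neg_add (a b : ℝ) (k : ℕ) :
    newtonS (a * b) (-(a + b)) k = (-a) ^ k + (-b) ^ k := by
  have h := newtonS_eq_add_pow (a := -(a : ℂ)) (b := -(b : ℂ)) (p := a * b) (α := -(a + b))
    (by push_cast; ring) (by push_cast; ring) k
  exact_mod_cast h

theorem powerSum_natCast_sub (s : Multiset ℝ) {k i : ℕ} (h : 2 * i ≤ k) :
    powerSum s ((k : ℤ) - 2 * (i : ℤ)) = (s.map fun α => α ^ (k - 2 * i)).sum := by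
  rw [powerSum, if_pos (by omega), show ((k : ℤ) - 2 * (i : ℤ)).toNat = k - 2 * i by omega]

theorem powerSum_of_neg (s : Multiset ℝ) {j : ℤ} (h : j < 0) : powerSum s j = 0 :=
  if_neg (by omega)

theorem sum_map_newtonS (s : Multiset ℝ) (p : ℝ) {k : ℕ} (hk : 1 ≤ k) :
    (s.map fun α => newtonS p α k).sum =
      powerSum s k - (k : ℝ) * p * powerSum s ((k : ℤ) - 2)
        + (k : ℝ) * ((k : ℝ) - 3) / 2 * p ^ 2 * powerSum s ((k : ℤ) - 4)
        - (k : ℝ) * ((k : ℝ) - 4) * ((k : ℝ) - 5) / 6 * p ^ 3 * powerSum s ((k : ℤ) - 6)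
        + ∑ i ∈ Finset.Icc 4 (k / 2), (-1 : ℝ) ^ i * (newtonCoeff k i : ℝ) * p ^ i *
          powerSum s ((k : ℤ) - 2 * (i : ℤ)) := by
  set a : ℕ → ℝ := fun i => (-1 : ℝ) ^ i * (newtonCoeff k i : ℝ) * p ^ i *
    powerSum s ((k : ℤ) - 2 * (i : ℤ)) with ha
  have h0 : ∀ i, k < 2 * i → a i = 0 := fun i hi => by simp [a, newtonCoeff_eq_zero hi]
  -- The range is padded with zero terms so that four terms can be split off for every `k`.
  have hsum : (s.map fun α => newtonS p α k).sum = ∑ i ∈ Finset.range (k / 2 + 5), a i := by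
    have h1 : (s.map fun α => newtonS p α k).sum = (s.map fun α =>
        ∑ i ∈ Finset.range (k / 2 + 5),
          (-1 : ℝ) ^ i * (newtonCoeff k i : ℝ) * p ^ i * α ^ (k - 2 * i)).sum := by
      refine congrArg Multiset.sum (Multiset.map_congr rfl fun α _ => ?_)
      exact (sum_newtonCoeff_eq_newtonS p α k _ hk (by omega)).symm
    rw [h1, Multiset.sum_map_sum]
    refine Finset.sum_congr rfl fun i _ => ?_
    rw [Multiset.sum_map_mul_left]
    by_cases hi : 2 * i ≤ k
    · rw [ha, ← powerSum_natCast_sub s hi]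
    · rw [h0 i (by omega), newtonCoeff_eq_zero (by omega)]
      simp
  have htail : ∑ i ∈ Finset.Icc 4 (k / 2), a i = ∑ i ∈ Finset.Ico 4 (k / 2 + 5), a i := by
    refine Finset.sum_subset (fun i hi => ?_) fun i hi hi' => h0 i ?_
    · rw [Finset.mem_Icc] at hi
      exact Finset.mem_Ico.2 ⟨hi.1, by omega⟩
    · rw [Finset.mem_Ico] at hi
      rw [Finset.mem_Icc] at hi'
      omega
  have e0 : a 0 = powerSum s k := by simp [a, newtonCoeff_zero_right hk]
  -- For small `k` the closed form of the coefficient can fail, but it then multiplies a power sum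
  -- of negative index, which is zero. The same holds for `e2` and `e3`.
  have e1 : a 1 = -((k : ℝ) * p * powerSum s ((k : ℤ) - 2)) := by
    by_cases h : 2 ≤ k
    · simp [a, newtonCoeff_one_right h]
    · rw [h0 1 (by omega), powerSum_of_neg s (by omega)]
      simp
  have e2 : a 2 = (k : ℝ) * ((k : ℝ) - 3) / 2 * p ^ 2 * powerSum s ((k : ℤ) - 4) := by
    by_cases h : 4 ≤ k
    · simp [a, newtonCoeff_two_right h]
    · rw [h0 2 (by omega), powerSum_of_neg s (by omega)]
      simp
  have e3 : a 3 = -((k : ℝ) * ((k : ℝ) - 4) * ((k : ℝ) - 5) / 6 * p ^ 3 *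
      powerSum s ((k : ℤ) - 6)) := by
    by_cases h : 6 ≤ k
    · simp only [a, newtonCoeff_three_right h]
      norm_num
    · rw [h0 3 (by omega), powerSum_of_neg s (by omega)]
      simp
  rw [hsum, htail, ← Finset.sum_range_add_sum_Ico a (show 4 ≤ k / 2 + 5 by omega)]
  simp only [Finset.sum_range_succ, Finset.sum_range_zero, e0, e1, e2, e3]
  ring

/-- Up to `k = 7` the coefficient of `p³` agrees with `k² - 8k + 14` wherever it matters. -/
theorem cubic_coeff_mul_powerSum (s : Multiset ℝ) (p : ℝ) {k : ℕ} (hk : k ≤ 7) :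
    (k : ℝ) * ((k : ℝ) - 4) * ((k : ℝ) - 5) / 6 * p ^ 3 * powerSum s ((k : ℤ) - 6) =
      ((k : ℝ) ^ 2 - 8 * (k : ℝ) + 14) * p ^ 3 * powerSum s ((k : ℤ) - 6) := by
  by_cases h : k < 6
  · rw [powerSum_of_neg s (by omega)]
    simp
  -- Both polynomials take the value 2 at `k = 6` and 7 at `k = 7`.
  · obtain rfl | rfl : k = 6 ∨ k = 7 := by omega
    all_goals norm_num

end NewtonCoeff

/-! ### Nonzero eigenvalues, rank and the excluded value -/

section Eigenvalues

open Polynomial Matrix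

/-- The excluded value `-(q₁ + q₂)` is the shift of the eigenvalue 0 of `H Hᵀ`. -/
theorem alphas_eq_map {I J : Type*} [Fintype I] [DecidableEq I] [Fintype J] (H : Matrix I J ℝ)
    (hH : (H * Hᵀ).IsHermitian) (q₁ q₂ : ℕ) :
    alphas H q₁ q₂ = (Finset.univ.filter fun i => hH.eigenvalues i ≠ 0).val.map
      fun i => hH.eigenvalues i - (q₁ + q₂) := by
  have h1 : (H * Hᵀ - ((q₁ : ℝ) + q₂) • (1 : Matrix I I ℝ)).charpoly =
      ∏ i, (X - C (hH.eigenvalues i - (q₁ + q₂))) := by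
    rw [Matrix.smul_one_eq_diagonal, ← Matrix.scalar_apply, Matrix.charpoly_sub_scalar,
      hH.charpoly_eq, Polynomial.prod_comp]
    refine Finset.prod_congr rfl fun i _ => ?_
    simp only [sub_comp, X_comp, C_comp, RCLike.ofReal_real_eq_id, id_eq, C_sub]
    ring
  have h2 : (∏ i, (X - C (hH.eigenvalues i - ((q₁ : ℝ) + q₂)))).roots =
      Finset.univ.val.map fun i => hH.eigenvalues i - ((q₁ : ℝ) + q₂) := by
    have h := roots_multiset_prod_X_sub_C
      (Finset.univ.val.map fun i => hH.eigenvalues i - ((q₁ : ℝ) + q₂))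
    rw [Multiset.map_map] at h
    exact h
  rw [alphas, h1, h2, Multiset.filter_map, Finset.filter_val]
  congr 1
  refine Multiset.filter_congr fun i _ => ?_
  simp [sub_eq_add_neg]

theorem rank_eq_card_alphas {I J : Type*} [Fintype I] [DecidableEq I] [Fintype J]
    (H : Matrix I J ℝ) (q₁ q₂ : ℕ) : H.rank = (alphas H q₁ q₂).card := by
  have hH : (H * Hᵀ).IsHermitian := by
    rw [Matrix.IsHermitian, Matrix.conjTranspose_eq_transpose_of_trivial, Matrix.transpose_mul,
      Matrix.transpose_transpose]
  rw [alphas_eq_map H hH, ← Matrix.rank_self_mul_transpose, hH.rank_eq_card_non_zero_eigs,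
    Fintype.card_subtype, Multiset.card_map, Finset.card_val]

theorem sum_newtonS_eigenvalues {I J : Type*} [Fintype I] [DecidableEq I] [Fintype J]
    (H : Matrix I J ℝ) (hH : (H * Hᵀ).IsHermitian) (q₁ q₂ k : ℕ) :
    ∑ i, newtonS ((q₁ : ℝ) * q₂) (hH.eigenvalues i - (q₁ + q₂)) k =
      ((alphas H q₁ q₂).map fun α => newtonS ((q₁ : ℝ) * q₂) α k).sum +
        (Fintype.card I - H.rank) * ((-(q₁ : ℝ)) ^ k + (-(q₂ : ℝ)) ^ k) := by
  rw [← Finset.sum_filter_add_sum_filter_not Finset.univ fun i => hH.eigenvalues i ≠ 0]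
  have hcard := Finset.card_filter_add_card_filter_not (s := (Finset.univ : Finset I))
    fun i => hH.eigenvalues i ≠ 0
  have hrank : H.rank = (Finset.univ.filter fun i => hH.eigenvalues i ≠ 0).card := by
    rw [rank_eq_card_alphas H q₁ q₂, alphas_eq_map H hH, Multiset.card_map, Finset.card_val]
  rw [Finset.card_univ, ← hrank] at hcard
  congr 1
  · rw [alphas_eq_map H hH, Multiset.map_map]
    rfl
  · rw [← hcard, Finset.sum_congr rfl (g := fun _ => (-(q₁ : ℝ)) ^ k + (-(q₂ : ℝ)) ^ k),
      Finset.sum_const, nsmul_eq_mul]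
    · push_cast
      ring
    · intro i hi
      have h0 : hH.eigenvalues i = 0 := by simpa using hi
      rw [h0, zero_sub, newtonS_neg_add]

end Eigenvalues

/-! ### The two evaluations of the trace compared -/

section CycleFormula

variable {V : Type*} [Fintype V] [DecidableEq V] {G : SimpleGraph V} [DecidableRel G.Adj]
  {U W : Finset V} {q₁ q₂ : ℕ}

theorem two_mul_mul_numCycles (hUW : U ∪ W = Finset.univ)
    (hG : G.IsBipartiteWith (U : Set V) (W : Set V))
    (hU : ∀ u ∈ U, G.degree u = q₁ + 1) (hW : ∀ w ∈ W, G.degree w = q₂ + 1) {k : ℕ}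
    (hk : 1 ≤ k) (hg : k < G.girth) :
    2 * (k : ℝ) * numCycles G (2 * k) =
      (G.edgeFinset.card : ℝ) - ((W.card : ℝ) + U.card)
        + (-(q₁ : ℝ)) ^ k * ((U.card : ℝ) - (biadj G U W).rank)
        + (-(q₂ : ℝ)) ^ k * ((W.card : ℝ) - (biadj G U W).rank)
        + ((alphas (biadj G U W) q₁ q₂).map fun α => newtonS ((q₁ : ℝ) * q₂) α k).sum := by
  have : NeZero (2 * k) := ⟨by omega⟩
  have h1 : ((nonbacktrackingMatrix G ℂ) ^ (2 * k)).trace =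
      ((4 * k * numCycles G (2 * k) : ℝ) : ℂ) := by
    rw [nonbacktrackingMatrix, trace_pow_eq_card, Nat.card_congr (dartSequenceEquiv G (2 * k)),
      card_isClosedNonbacktracking hk hg]
    push_cast
    ring
  rw [trace_nonbacktrackingMatrix_pow hUW hG hU hW, Complex.ofReal_inj,
    sum_newtonS_eigenvalues, Fintype.card_coe] at h1
  have hV : (Fintype.card V : ℝ) = W.card + U.card := by
    have h := Fintype.card_congr (partsEquiv hUW hG)
    rw [Fintype.card_sum, Fintype.card_coe, Fintype.card_coe] at h
    rw [← h]
    push_cast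
    ring
  rw [hV] at h1
  -- The term `(n - m)(-q₁)^k` and the `m - μ` zero eigenvalues combine to `(n - μ)(-q₁)^k + (m -
  -- μ)(-q₂)^k`.
  linear_combination -h1 / 2

theorem card_edgeFinset_eq_left (hG : G.IsBipartiteWith (U : Set V) (W : Set V))
    (hU : ∀ u ∈ U, G.degree u = q₁ + 1) : G.edgeFinset.card = U.card * (q₁ + 1) := by
  rw [← SimpleGraph.isBipartiteWith_sum_degrees_eq_card_edges hG, Finset.sum_congr rfl hU,
    Finset.sum_const, smul_eq_mul]

end CycleFormula

end CycleCount

theorem mainTheorem5 :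
    -- the coefficients solve the recursion, and the first four of them are explicit
    ((∀ (p α : ℝ) (k : ℕ), 1 ≤ k →
        CycleCount.newtonS p α k =
          ∑ i ∈ Finset.range (k / 2 + 1),
            (-1 : ℝ) ^ i * (CycleCount.newtonCoeff k i : ℝ) * p ^ i * α ^ (k - 2 * i)) ∧
      (∀ k : ℕ, 1 ≤ k → CycleCount.newtonCoeff k 0 = 1) ∧
      (∀ k : ℕ, 2 ≤ k → CycleCount.newtonCoeff k 1 = k) ∧
      (∀ k : ℕ, 4 ≤ k →
        (CycleCount.newtonCoeff k 2 : ℝ) = (k : ℝ) * ((k : ℝ) - 3) / 2) ∧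
      (∀ k : ℕ, 6 ≤ k →
        (CycleCount.newtonCoeff k 3 : ℝ) = (k : ℝ) * ((k : ℝ) - 4) * ((k : ℝ) - 5) / 6)) ∧
    -- the formulas for the number of cycles
    ∀ {V : Type*} [Fintype V] [DecidableEq V] (G : SimpleGraph V) [DecidableRel G.Adj]
      (U W : Finset V) (n m q₁ q₂ μ : ℕ) (E : ℤ → ℝ),
      G.Connected →
      U ∪ W = Finset.univ →
      G.IsBipartiteWith (U : Set V) (W : Set V) →
      (∀ u ∈ U, G.degree u = q₁ + 1) →
      (∀ w ∈ W, G.degree w = q₂ + 1) →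
      1 ≤ q₁ → 2 ≤ q₂ → q₁ ≤ q₂ →
      U.card = n → W.card = m →
      μ = (CycleCount.biadj G U W).rank →
      E = CycleCount.powerSum (CycleCount.alphas (CycleCount.biadj G U W) q₁ q₂) →
      μ = (CycleCount.alphas (CycleCount.biadj G U W) q₁ q₂).card ∧
      ∀ k : ℕ, 1 ≤ k → k < G.girth →
        -- first form
        (CycleCount.numCycles G (2 * k) : ℝ) =
          ((G.edgeFinset.card : ℝ) - ((m : ℝ) + n)
            + (-(q₁ : ℝ)) ^ k * ((n : ℝ) - μ) + (-(q₂ : ℝ)) ^ k * ((m : ℝ) - μ)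
            + (E k - (k : ℝ) * ((q₁ : ℝ) * q₂) * E ((k : ℤ) - 2)
              + (k : ℝ) * ((k : ℝ) - 3) / 2 * ((q₁ : ℝ) * q₂) ^ 2 * E ((k : ℤ) - 4)
              - (k : ℝ) * ((k : ℝ) - 4) * ((k : ℝ) - 5) / 6
                * ((q₁ : ℝ) * q₂) ^ 3 * E ((k : ℤ) - 6)
              + ∑ i ∈ Finset.Icc 4 (k / 2), (-1 : ℝ) ^ i * (CycleCount.newtonCoeff k i : ℝ)
                * ((q₁ : ℝ) * q₂) ^ i * E ((k : ℤ) - 2 * (i : ℤ)))) / (2 * (k : ℝ)) ∧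
        -- second form, through the number of edges and the rank only
        (CycleCount.numCycles G (2 * k) : ℝ) =
          ((G.edgeFinset.card : ℝ) * (1 + ((-(q₁ : ℝ)) ^ k - 1) / ((q₁ : ℝ) + 1)
              + ((-(q₂ : ℝ)) ^ k - 1) / ((q₂ : ℝ) + 1))
            - (μ : ℝ) * ((-(q₁ : ℝ)) ^ k + (-(q₂ : ℝ)) ^ k)
            + (E k - (k : ℝ) * ((q₁ : ℝ) * q₂) * E ((k : ℤ) - 2)
              + (k : ℝ) * ((k : ℝ) - 3) / 2 * ((q₁ : ℝ) * q₂) ^ 2 * E ((k : ℤ) - 4)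
              - (k : ℝ) * ((k : ℝ) - 4) * ((k : ℝ) - 5) / 6
                * ((q₁ : ℝ) * q₂) ^ 3 * E ((k : ℤ) - 6)
              + ∑ i ∈ Finset.Icc 4 (k / 2), (-1 : ℝ) ^ i * (CycleCount.newtonCoeff k i : ℝ)
                * ((q₁ : ℝ) * q₂) ^ i * E ((k : ℤ) - 2 * (i : ℤ)))) / (2 * (k : ℝ)) ∧
        -- for `k ≤ 7` the fourth coefficient also reads `k² - 8k + 14`, and nothing follows it
        (k ≤ 7 →
          (CycleCount.numCycles G (2 * k) : ℝ) =
            ((G.edgeFinset.card : ℝ) - ((m : ℝ) + n)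
              + (-(q₁ : ℝ)) ^ k * ((n : ℝ) - μ) + (-(q₂ : ℝ)) ^ k * ((m : ℝ) - μ)
              + (E k - (k : ℝ) * ((q₁ : ℝ) * q₂) * E ((k : ℤ) - 2)
                + (k : ℝ) * ((k : ℝ) - 3) / 2 * ((q₁ : ℝ) * q₂) ^ 2 * E ((k : ℤ) - 4)
                - ((k : ℝ) ^ 2 - 8 * (k : ℝ) + 14)
                  * ((q₁ : ℝ) * q₂) ^ 3 * E ((k : ℤ) - 6))) / (2 * (k : ℝ)) ∧
          (CycleCount.numCycles G (2 * k) : ℝ) =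
            ((G.edgeFinset.card : ℝ) * (1 + ((-(q₁ : ℝ)) ^ k - 1) / ((q₁ : ℝ) + 1)
                + ((-(q₂ : ℝ)) ^ k - 1) / ((q₂ : ℝ) + 1))
              - (μ : ℝ) * ((-(q₁ : ℝ)) ^ k + (-(q₂ : ℝ)) ^ k)
              + (E k - (k : ℝ) * ((q₁ : ℝ) * q₂) * E ((k : ℤ) - 2)
                + (k : ℝ) * ((k : ℝ) - 3) / 2 * ((q₁ : ℝ) * q₂) ^ 2 * E ((k : ℤ) - 4)
                - ((k : ℝ) ^ 2 - 8 * (k : ℝ) + 14)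
                  * ((q₁ : ℝ) * q₂) ^ 3 * E ((k : ℤ) - 6))) / (2 * (k : ℝ))) := by
  refine ⟨⟨fun p α k hk => ?_, fun k => CycleCount.newtonCoeff_zero_right,
    fun k => CycleCount.newtonCoeff_one_right, fun k => CycleCount.newtonCoeff_two_right,
    fun k => CycleCount.newtonCoeff_three_right⟩, ?_⟩
  · exact (CycleCount.sum_newtonCoeff_eq_newtonS p α k _ hk (by omega)).symm
  intro V _ _ G _ U W n m q₁ q₂ μ E _ hUW hG hU hW _ _ _ hn hm hμ hE
  refine ⟨hμ ▸ CycleCount.rank_eq_card_alphas _ _ _, fun k hk hg => ?_⟩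
  have hcount := CycleCount.two_mul_mul_numCycles hUW hG hU hW hk hg
  rw [CycleCount.sum_map_newtonS _ _ hk, ← hE, ← hμ, hn, hm] at hcount
  have hk0 : (2 * (k : ℝ)) ≠ 0 := by positivity
  have hEU : (G.edgeFinset.card : ℝ) = n * (q₁ + 1) := by
    rw [CycleCount.card_edgeFinset_eq_left hG hU, hn]
    push_cast
    ring
  have hEW : (G.edgeFinset.card : ℝ) = m * (q₂ + 1) := by
    rw [CycleCount.card_edgeFinset_eq_left hG.symm hW, hm]
    push_cast
    ring
  have hq₁ : (q₁ : ℝ) + 1 ≠ 0 := by positivity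
  have hq₂ : (q₂ : ℝ) + 1 ≠ 0 := by positivity
  -- Counting edges from either side gives `|E| = n(q₁ + 1) = m(q₂ + 1)`, which eliminates `n` and
  -- `m`.
  have hedges : (G.edgeFinset.card : ℝ) * (1 + ((-(q₁ : ℝ)) ^ k - 1) / ((q₁ : ℝ) + 1)
      + ((-(q₂ : ℝ)) ^ k - 1) / ((q₂ : ℝ) + 1)) - (μ : ℝ) * ((-(q₁ : ℝ)) ^ k + (-(q₂ : ℝ)) ^ k) =
      (G.edgeFinset.card : ℝ) - ((m : ℝ) + n)
        + (-(q₁ : ℝ)) ^ k * ((n : ℝ) - μ) + (-(q₂ : ℝ)) ^ k * ((m : ℝ) - μ) := by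
    have h1 : (G.edgeFinset.card : ℝ) * (((-(q₁ : ℝ)) ^ k - 1) / ((q₁ : ℝ) + 1)) =
        n * ((-(q₁ : ℝ)) ^ k - 1) := by
      rw [hEU]; field_simp
    have h2 : (G.edgeFinset.card : ℝ) * (((-(q₂ : ℝ)) ^ k - 1) / ((q₂ : ℝ) + 1)) =
        m * ((-(q₂ : ℝ)) ^ k - 1) := by
      rw [hEW]; field_simp
    linear_combination h1 + h2
  rw [hedges, eq_div_iff hk0, eq_div_iff hk0]
  refine ⟨by linear_combination hcount, by linear_combination hcount, fun hk7 => ?_⟩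
  have hcub := CycleCount.cubic_coeff_mul_powerSum
    (CycleCount.alphas (CycleCount.biadj G U W) q₁ q₂) ((q₁ : ℝ) * q₂) hk7
  rw [← hE] at hcub
  -- For `k ≤ 7` one has `k / 2 ≤ 3`, so the tail is empty.
  rw [Finset.Icc_eq_empty (by omega), Finset.sum_empty] at hcount
  exact ⟨by linear_combination hcount - hcub, by linear_combination hcount - hcub⟩
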